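/- Let $m,d\ge 0$ be integers, $\mathbb N=\{1,2,\dots\}$, $\mathbb T^d=\mathbb R^d/\mathbb Z^d$, and let $\pi:\mathbb R^d\to\mathbb T^d$ be the natural projection. For a smooth curve $\gamma=(\gamma_1,\dots,\gamma_d):[0,1]\to\mathbb R^d$ write $\gamma^{(j)}(t)=(\gamma_1^{(j)}(t),\dots,\gamma_d^{(j)}(t))$, and define the order of rational non-degeneracy of $\gamma$ as $$\operatorname{ord}(\gamma)=\sup\left\{j\in\mathbb N : \text{for every } \mathbf h\in\mathbb Z^d\smallsetminus\{\mathbf 0\} \text{ the function } t\mapsto\langle \mathbf h,\gamma^{(j)}(t)\rangle \text{ is not identically zero on } [0,1]\right\}\in\{0\}\cup\mathbb N\cup\{\infty\},$$ where $\sup\emptyset=0$. A family of smooth curves $\phi:[0,1]^m\times[0,1]\to\mathbb R^d$ is called rationally non-degenerate (RND) of order $\kappa$ if $\kappa=\inf\{\operatorname{ord}(\phi(\mathbf x,\cdot)) : \mathbf x\in[0,1]^m\}$. **Theorem 1.2.** Let $\phi:[0,1]^m\times[0,1]\to\mathbb R^d$ be analytic (that is, the restriction of a real analytic function defined on a neighbourhood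 of $[0,1]^m\times[0,1]$), and suppose that the family of curves $\phi$ is RND of order $\kappa$, where $2\le\kappa\le\infty$. Let $\{\rho_n\}_{n\ge1}\subseteq\mathbb R$ be a sequence with $\rho_n\to\infty$ such that - $\rho_n=o(n^{\kappa})$ if $\kappa<\infty$; - $\rho_n=o(n^{l})$ for some $l\in\mathbb Z_{\ge0}$ if $\kappa=\infty$. Let $\{\mathbf x_n\}_{n\ge1}\subseteq[0,1]^m$ be any sequence. Then the probability measures $$\mu_n=\frac1n\sum_{k=1}^{n}\delta_{\pi\left(\rho_n\phi(\mathbf x_n,k/n)\right)}$$ equidistribute on $\mathbb T^d$, that is, for every continuous function $f:\mathbb T^d\to\mathbb C$, $$\lim_{n\to\infty}\int_{\mathbb T^d} f\,d\mu_n=\int_{\mathbb T^d}f\,d\mathbf x,$$ where $d\mathbf x$ is the normalized Haar measure on $\mathbb T^d$. -/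

import Mathlib

open Filter Topology MeasureTheory Asymptotics

noncomputable section

namespace DilatingCurves

/-- The parameter cube `[0,1]^m`. -/
def cube (m : ℕ) : Set (Fin m → ℝ) := Set.Icc 0 1

/-- Analyticity of a family of curves `φ : [0,1]^m × [0,1] → ℝ^d`: the function `φ` is the
restriction to `[0,1]^m × [0,1]` of a function which is real analytic in a neighbourhood of
`[0,1]^m × [0,1]`. The values of `φ` outside of `[0,1]^m × [0,1]` play no role. -/
def IsAnalyticFamily {m d : ℕ} (φ : (Fin m → ℝ) → ℝ → (Fin d → ℝ)) : Prop :=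
  ∃ ψ : (Fin m → ℝ) × ℝ → (Fin d → ℝ),
    AnalyticOnNhd ℝ ψ (cube m ×ˢ Set.Icc (0 : ℝ) 1) ∧
      ∀ x ∈ cube m, ∀ t ∈ Set.Icc (0 : ℝ) 1, φ x t = ψ (x, t)

/-- The vector `γ^{(j)}(t)` of the `j`-th derivatives of the coordinates of a (smooth) curve
`γ : [0,1] → ℝ^d`; the derivatives at the endpoints are one-sided. -/
def curveDeriv {d : ℕ} (γ : ℝ → (Fin d → ℝ)) (j : ℕ) (t : ℝ) : Fin d → ℝ :=
  fun i => iteratedDerivWithin j (fun s => γ s i) (Set.Icc (0 : ℝ) 1) t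

/-- The set of the `j ≥ 1` such that for every nonzero `h ∈ ℤ^d` the function
`t ↦ ⟨h, γ^{(j)}(t)⟩` is not identically zero on `[0,1]`. -/
def nondegenerateOrders {d : ℕ} (γ : ℝ → (Fin d → ℝ)) : Set ℕ :=
  {j | 1 ≤ j ∧ ∀ h : Fin d → ℤ, h ≠ 0 →
    ∃ t ∈ Set.Icc (0 : ℝ) 1, ∑ i, (h i : ℝ) * curveDeriv γ j t i ≠ 0}

/-- The order of rational non-degeneracy, in `ℕ ∪ {∞}`, of a smooth curve
`γ : [0,1] → ℝ^d`. -/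
def curveOrder {d : ℕ} (γ : ℝ → (Fin d → ℝ)) : ℕ∞ :=
  ⨆ j ∈ nondegenerateOrders γ, (j : ℕ∞)

/-- The order of rational non-degeneracy, in `ℕ ∪ {∞}`, of a family of smooth curves
`φ : [0,1]^m × [0,1] → ℝ^d`. -/
def familyOrder {m d : ℕ} (φ : (Fin m → ℝ) → ℝ → (Fin d → ℝ)) : ℕ∞ :=
  ⨅ x ∈ cube m, curveOrder (φ x)

/-- The family `φ` of smooth curves is rationally non-degenerate of order `κ`. -/
def IsRND {m d : ℕ} (φ : (Fin m → ℝ) → ℝ → (Fin d → ℝ)) (κ : ℕ∞) : Prop :=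
  κ = familyOrder φ

/-- The natural projection `π : ℝ^d → 𝕋^d = (ℝ/ℤ)^d`. -/
def torusProj {d : ℕ} (v : Fin d → ℝ) : UnitAddTorus (Fin d) :=
  fun i => (v i : UnitAddCircle)

/-- The measure `(1/n) ∑_{k=1}^n δ_{π(γ(k/n))}` on `𝕋^d`. -/
def countingMeasure {d : ℕ} (γ : ℝ → (Fin d → ℝ)) (n : ℕ) :
    Measure (UnitAddTorus (Fin d)) :=
  (n : ENNReal)⁻¹ • ∑ k ∈ Finset.Icc 1 n, Measure.dirac (torusProj (γ ((k : ℝ) / (n : ℝ))))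

/-- A sequence of measures on `𝕋^d` equidistributes: the integrals of every continuous function
converge to its integral against the normalized Haar measure of `𝕋^d` (which is `volume`). -/
def Equidistributes {d : ℕ} (μ : ℕ → Measure (UnitAddTorus (Fin d))) : Prop :=
  ∀ f : C(UnitAddTorus (Fin d), ℂ),
    Tendsto (fun n => ∫ z, f z ∂(μ n)) atTop (𝓝 (∫ z, f z))

end DilatingCurves

end

noncomputable section

namespace DilatingCurves

open scoped ContDiff

/-! By Weyl's criterion (`equidistributes_of_expSum`) it suffices that, for each nonzero integer
vector `h`, the normalized exponential sum with phase `ρ n * ⟨h, φ (x n) t⟩` tends to 0. Convergence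
is tested along ultrafilters. By compactness of the cube, `x n` then converges to some `y`, and `⟨h,
φ (x n) ·⟩` converges with all derivatives to `f = ⟨h, φ y ·⟩`. If `j` is the least exponent with `ρ
n = o(n^j)` along the ultrafilter, then `ρ n` is at least `c * n^(j-1)` for some `c > 0` when `j ≥
2`, while `ρ n → ∞` serves when `j = 1`. Non-degeneracy says that the `j`-th derivative of `f` is
not identically zero on `[0,1]`, so by analyticity it is nonzero almost everywhere
(`ae_iteratedDeriv_ne_zero`).

The sum is bounded by a derivative test of order `j`. For `j = 1` (`derivativeTest_one`) the sum is
a Riemann sum within `O(ρ n / n) = o(1)` of an integral. That integral is small by integration by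
parts against the weight `F'^2 / (F'^2 + δ)`, which needs nothing about stationary points beyond `f'
≠ 0` almost everywhere.

The passage from `j` to `j + 1` (`DerivativeTest.succ`) is van der Corput differencing. Correlating
the shifts `b` and `d` replaces `a * F` by `(b - d) * a / n` times a difference quotient that
converges to `f'`. The test of order `j` asks for an amplitude at least `A * n^(j-1)` with `A`
depending on `f` and `ε`. For most pairs `|b - d|` is large, which lifts any constant `c > 0` above
`A`. -/

/-! ### Characters of the real line and smooth functions -/

/-- The unitary character `x ↦ exp (2πix)`. -/
def phase (x : ℝ) : ℂ := Complex.exp ((2 * Real.pi * x : ℝ) * Complex.I)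

/-- The normalized exponential sum `(1/n) ∑_{k=1}^n exp (2πi G(k/n))`. -/
def expSum (n : ℕ) (G : ℝ → ℝ) : ℂ :=
  (n : ℂ)⁻¹ * ∑ k ∈ Finset.Icc 1 n, phase (G ((k : ℝ) / n))

lemma norm_phase (x : ℝ) : ‖phase x‖ = 1 := Complex.norm_exp_ofReal_mul_I _

lemma phase_add (x y : ℝ) : phase (x + y) = phase x * phase y := by
  simp only [phase, ← Complex.exp_add]
  push_cast
  ring_nf

lemma conj_phase (x : ℝ) : (starRingEnd ℂ) (phase x) = phase (-x) := by
  simp only [phase, ← Complex.exp_conj, map_mul, Complex.conj_ofReal, Complex.conj_I]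
  push_cast
  ring_nf

lemma continuous_phase : Continuous phase := by
  unfold phase
  fun_prop

lemma norm_phase_sub_phase_le (x y : ℝ) : ‖phase x - phase y‖ ≤ 2 * Real.pi * |x - y| := by
  have h : phase x - phase y
      = (Complex.exp (Complex.I * (2 * Real.pi * (x - y) : ℝ)) - 1) * phase y := by
    have : phase x = phase (x - y) * phase y := by rw [← phase_add]; ring_nf
    rw [this, sub_mul, one_mul, phase, mul_comm Complex.I]
  rw [h, norm_mul, norm_phase, mul_one]
  refine (Real.norm_exp_I_mul_ofReal_sub_one_le).trans ?_
  rw [Real.norm_eq_abs, abs_mul, abs_of_pos Real.two_pi_pos]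

lemma hasDerivAt_phase_comp {g : ℝ → ℝ} {g' t : ℝ} (hg : HasDerivAt g g' t) :
    HasDerivAt (fun s => phase (g s)) (phase (g t) * ((2 * Real.pi * g' : ℝ) * Complex.I)) t := by
  unfold phase
  have h := (((hg.const_mul (2 * Real.pi)).ofReal_comp).mul_const Complex.I).cexp
  exact h

lemma continuous_iteratedDeriv_of_smooth {F : ℝ → ℝ} (hF : ContDiff ℝ ∞ F) (i : ℕ) :
    Continuous (iteratedDeriv i F) :=
  hF.continuous_iteratedDeriv i (by exact_mod_cast le_top)

lemma differentiable_iteratedDeriv_of_smooth {F : ℝ → ℝ} (hF : ContDiff ℝ ∞ F) (i : ℕ) :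
    Differentiable ℝ (iteratedDeriv i F) :=
  hF.differentiable_iteratedDeriv i (by exact_mod_cast ENat.natCast_lt_top i)

/-! ### Riemann sums and oscillatory integrals -/

/-- A Riemann sum of a Lipschitz function is close to the integral. -/
lemma norm_riemann_sum_sub_integral_le {g : ℝ → ℂ} {K : ℝ} (hg : Continuous g)
    (hK : ∀ s ∈ Set.Icc (0 : ℝ) 1, ∀ t ∈ Set.Icc (0 : ℝ) 1, ‖g s - g t‖ ≤ K * |s - t|)
    (hK0 : 0 ≤ K) {n : ℕ} (hn : 0 < n) :
    ‖(n : ℂ)⁻¹ * ∑ k ∈ Finset.Icc 1 n, g ((k : ℝ) / n) - ∫ t in (0 : ℝ)..1, g t‖ ≤ K / n := by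
  have hn' : (0 : ℝ) < n := by exact_mod_cast hn
  have hint : ∀ a b, IntervalIntegrable g volume a b := fun a b => hg.intervalIntegrable a b
  have h1 : ∫ t in (0 : ℝ)..1, g t
      = ∑ k ∈ Finset.range n, ∫ t in ((k : ℕ) : ℝ) / n..((k + 1 : ℕ) : ℝ) / n, g t := by
    rw [intervalIntegral.sum_integral_adjacent_intervals (a := fun k : ℕ => (k : ℝ) / n)
      (fun k _ => hint _ _)]
    simp [hn'.ne']
  have h2 : (n : ℂ)⁻¹ * ∑ k ∈ Finset.Icc 1 n, g ((k : ℝ) / n)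
      = ∑ k ∈ Finset.range n,
        ∫ _ in ((k : ℕ) : ℝ) / n..((k + 1 : ℕ) : ℝ) / n, g (((k + 1 : ℕ) : ℝ) / n) := by
    have h3 : Finset.Icc 1 n = Finset.Ico 1 (n + 1) := rfl
    rw [h3, Finset.sum_Ico_eq_sum_range, Finset.mul_sum]
    refine Finset.sum_congr rfl fun k _ => ?_
    rw [intervalIntegral.integral_const, add_comm 1 k]
    have : ((k + 1 : ℕ) : ℝ) / n - (k : ℝ) / n = (n : ℝ)⁻¹ := by
      push_cast; field_simp; ring
    rw [this, Complex.real_smul]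
    push_cast
    rfl
  rw [h1, h2, ← Finset.sum_sub_distrib]
  have h4 : ∀ k ∈ Finset.range n,
      ‖(∫ _ in ((k : ℕ) : ℝ) / n..((k + 1 : ℕ) : ℝ) / n, g (((k + 1 : ℕ) : ℝ) / n))
        - ∫ t in ((k : ℕ) : ℝ) / n..((k + 1 : ℕ) : ℝ) / n, g t‖ ≤ K / n * (n : ℝ)⁻¹ := by
    intro k hk
    have hk' : (k : ℝ) + 1 ≤ n := by exact_mod_cast Finset.mem_range.1 hk
    rw [← intervalIntegral.integral_sub intervalIntegrable_const (hint _ _)]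
    have hlen : ((k + 1 : ℕ) : ℝ) / n - (k : ℝ) / n = (n : ℝ)⁻¹ := by
      push_cast; field_simp; ring
    have hle : (k : ℝ) / n ≤ ((k + 1 : ℕ) : ℝ) / n := by
      rw [← sub_nonneg, hlen]; positivity
    have h0 : 0 ≤ (k : ℝ) / n := by positivity
    have h01 : ((k + 1 : ℕ) : ℝ) / n ≤ 1 := by
      rw [div_le_one hn']; push_cast; exact hk'
    have := intervalIntegral.norm_integral_le_of_norm_le_const (a := (k : ℝ) / n)
      (b := ((k + 1 : ℕ) : ℝ) / n) (C := K / n)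
      (f := fun t => g (((k + 1 : ℕ) : ℝ) / n) - g t) (fun t ht => by
        rw [Set.uIoc_of_le hle] at ht
        refine (hK _ ⟨h0.trans hle, h01⟩ _ ⟨h0.trans ht.1.le, ht.2.trans h01⟩).trans ?_
        rw [div_eq_mul_inv K, ← hlen, abs_of_nonneg (by linarith [ht.2])]
        exact mul_le_mul_of_nonneg_left (by linarith [ht.1]) hK0)
    rwa [hlen, abs_of_nonneg (by positivity)] at this
  refine (norm_sum_le_of_le _ h4).trans ?_
  rw [Finset.sum_const, Finset.card_range, nsmul_eq_mul]
  apply le_of_eq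
  field_simp

/-- The weight `y² / (y² + δ)`, evaluated at `y = F'`, has a small integral against the
oscillating factor `exp (2πiaF)`. -/
lemma norm_integral_weight_mul_phase_le {F : ℝ → ℝ} (hF : ContDiff ℝ ∞ F) {B₁ B₂ δ a : ℝ}
    (hδ : 0 < δ) (ha : a ≠ 0)
    (h₁ : ∀ t ∈ Set.Icc (0 : ℝ) 1, |iteratedDeriv 1 F t| ≤ B₁)
    (h₂ : ∀ t ∈ Set.Icc (0 : ℝ) 1, |iteratedDeriv 2 F t| ≤ B₂) :
    ‖∫ t in (0 : ℝ)..1, ((iteratedDeriv 1 F t ^ 2 / (iteratedDeriv 1 F t ^ 2 + δ) : ℝ) : ℂ) *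
      phase (a * F t)‖ ≤ (2 * B₁ + B₂) / δ / |a| := by
  set p := iteratedDeriv 1 F with hp
  set q := iteratedDeriv 2 F with hq
  have hFd : ∀ t, HasDerivAt F (p t) t := fun t => by
    rw [hp, iteratedDeriv_one]
    exact (hF.differentiable (by simp) t).hasDerivAt
  have hpd : ∀ t, HasDerivAt p (q t) t := fun t => by
    rw [hq, iteratedDeriv_succ, ← hp]
    exact (differentiable_iteratedDeriv_of_smooth hF 1 t).hasDerivAt
  have hpc : Continuous p := continuous_iteratedDeriv_of_smooth hF 1
  have hqc : Continuous q := continuous_iteratedDeriv_of_smooth hF 2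
  have hpos : ∀ t, 0 < p t ^ 2 + δ := fun t => by positivity
  -- Since `v * p` is the weight, the integrand is `v` times the derivative of the phase factor, up
  -- to the constant `2πia`. This is what gets integrated by parts.
  set v : ℝ → ℝ := fun t => p t / (p t ^ 2 + δ) with hv
  set w : ℝ → ℝ := fun t => (q t * (p t ^ 2 + δ) - p t * (2 * p t * q t)) / (p t ^ 2 + δ) ^ 2
    with hw
  have hvd : ∀ t, HasDerivAt v (w t) t := fun t => by
    have := (hpd t).div (((hpd t).pow 2).add_const δ) (hpos t).ne'
    refine this.congr_deriv ?_
    simp [hw]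
  have hvc : Continuous v := hpc.div (by fun_prop) fun t => (hpos t).ne'
  have hwc : Continuous w := by
    refine Continuous.div (by fun_prop) (by fun_prop) fun t => ?_
    have := hpos t
    positivity
  have hvb : ∀ t ∈ Set.Icc (0 : ℝ) 1, |v t| ≤ B₁ / δ := fun t ht => by
    simp only [hv]
    rw [abs_div, abs_of_pos (hpos t)]
    exact div_le_div₀ ((abs_nonneg _).trans (h₁ t ht)) (h₁ t ht) hδ
      (by nlinarith [sq_nonneg (p t)])
  have hwb : ∀ t ∈ Set.Icc (0 : ℝ) 1, |w t| ≤ B₂ / δ := fun t ht => by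
    have h0 := hpos t
    -- In this form `|δ - p^2| ≤ p^2 + δ` cancels one factor of the denominator.
    have e : w t = q t * ((δ - p t ^ 2) / (p t ^ 2 + δ) ^ 2) := by
      simp only [hw]; ring
    rw [e, abs_mul, div_eq_mul_inv B₂]
    refine mul_le_mul (h₂ t ht) ?_ (abs_nonneg _) ((abs_nonneg _).trans (h₂ t ht))
    rw [abs_div, abs_of_pos (by positivity : 0 < (p t ^ 2 + δ) ^ 2), div_le_iff₀ (by positivity)]
    have h3 : |δ - p t ^ 2| ≤ p t ^ 2 + δ := by
      rw [abs_le]; constructor <;> nlinarith [sq_nonneg (p t)]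
    refine h3.trans ?_
    rw [← div_eq_inv_mul, le_div_iff₀ hδ]
    nlinarith [sq_nonneg (p t), mul_nonneg h0.le (sq_nonneg (p t))]
  set u : ℝ → ℂ := fun t => phase (a * F t) with hu
  have hFc : Continuous F := hF.continuous
  have huc : Continuous u := continuous_phase.comp (by fun_prop)
  have hud : ∀ t, HasDerivAt u (u t * ((2 * Real.pi * (a * p t) : ℝ) * Complex.I)) t := fun t =>
    hasDerivAt_phase_comp ((hFd t).const_mul a)
  have hpic : Continuous fun t => u t * ((2 * Real.pi * (a * p t) : ℝ) * Complex.I) := by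
    fun_prop
  have hwc' : Continuous fun t => (w t : ℂ) := Complex.continuous_ofReal.comp hwc
  have ibp := intervalIntegral.integral_mul_deriv_eq_deriv_mul (a := (0 : ℝ)) (b := 1)
    (u := fun t => (v t : ℂ)) (v := u) (fun t _ => (hvd t).ofReal_comp) (fun t _ => hud t)
    (hwc'.intervalIntegrable _ _) (hpic.intervalIntegrable _ _)
  have hne : ((2 * Real.pi * a : ℝ) : ℂ) * Complex.I ≠ 0 := by
    refine mul_ne_zero ?_ Complex.I_ne_zero
    exact_mod_cast mul_ne_zero Real.two_pi_pos.ne' ha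
  have hlhs : (∫ t in (0 : ℝ)..1, (v t : ℂ) * (u t * ((2 * Real.pi * (a * p t) : ℝ) * Complex.I)))
      = ((2 * Real.pi * a : ℝ) : ℂ) * Complex.I *
        ∫ t in (0 : ℝ)..1, ((p t ^ 2 / (p t ^ 2 + δ) : ℝ) : ℂ) * u t := by
    rw [← intervalIntegral.integral_const_mul]
    congr 1
    ext t
    simp only [hv]
    push_cast
    ring
  rw [hlhs] at ibp
  have hbound : ‖(v 1 : ℂ) * u 1 - (v 0 : ℂ) * u 0 - ∫ t in (0 : ℝ)..1, (w t : ℂ) * u t‖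
      ≤ (2 * B₁ + B₂) / δ := by
    have i1 : ‖(v 1 : ℂ) * u 1‖ ≤ B₁ / δ := by
      rw [norm_mul, hu, norm_phase, mul_one, Complex.norm_real]; exact hvb 1 (by simp)
    have i2 : ‖(v 0 : ℂ) * u 0‖ ≤ B₁ / δ := by
      rw [norm_mul, hu, norm_phase, mul_one, Complex.norm_real]; exact hvb 0 (by simp)
    have i3 : ‖∫ t in (0 : ℝ)..1, (w t : ℂ) * u t‖ ≤ B₂ / δ := by
      have := intervalIntegral.norm_integral_le_of_norm_le_const (a := (0 : ℝ)) (b := 1)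
        (C := B₂ / δ) (f := fun t => (w t : ℂ) * u t) (fun t ht => by
          rw [Set.uIoc_of_le zero_le_one] at ht
          rw [norm_mul, hu, norm_phase, mul_one, Complex.norm_real]
          exact hwb t ⟨ht.1.le, ht.2⟩)
      simpa using this
    calc _ ≤ ‖(v 1 : ℂ) * u 1‖ + ‖(v 0 : ℂ) * u 0‖ + ‖∫ t in (0 : ℝ)..1, (w t : ℂ) * u t‖ :=
          (norm_sub_le _ _).trans (add_le_add_left (norm_sub_le _ _) _)
      _ ≤ B₁ / δ + B₁ / δ + B₂ / δ := by gcongr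
      _ = _ := by ring
  rw [← ibp, norm_mul, norm_mul, Complex.norm_I, mul_one, Complex.norm_real, Real.norm_eq_abs,
    abs_mul, abs_of_pos Real.two_pi_pos] at hbound
  rw [le_div_iff₀ (abs_pos.2 ha), mul_comm]
  refine le_trans ?_ hbound
  gcongr
  nlinarith [Real.pi_gt_three, abs_nonneg a]

/-! ### Convergence with all derivatives -/

/-- The smooth functions `F n` converge to the smooth function `f` along `l`, locally uniformly
together with all their derivatives. -/
structure SmoothConv (l : Filter ℕ) (F : ℕ → ℝ → ℝ) (f : ℝ → ℝ) : Prop where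
  smooth : ∀ n, ContDiff ℝ ∞ (F n)
  smooth_lim : ContDiff ℝ ∞ f
  tendsto : ∀ i t, Tendsto (fun p : ℕ × ℝ => iteratedDeriv i (F p.1) p.2) (l ×ˢ 𝓝 t)
    (𝓝 (iteratedDeriv i f t))

/-- A tube-lemma argument: it turns the pointwise-local limits in `SmoothConv` into uniform bounds
on `[0,1]`. -/
lemma eventually_forall_of_forall_eventually_prod {X Y : Type*} [TopologicalSpace Y]
    {l : Filter X} {K : Set Y} (hK : IsCompact K) {P : X → Y → Prop}
    (h : ∀ y ∈ K, ∀ᶠ z in l ×ˢ 𝓝 y, P z.1 z.2) : ∀ᶠ x in l, ∀ y ∈ K, P x y := by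
  have h1 : ∀ᶠ z in l ×ˢ 𝓝ˢ K, P z.1 z.2 := hK.mem_prod_nhdsSet_of_forall h
  filter_upwards [h1.curry] with x hx y hy
  exact (hx.self_of_nhdsSet) y hy

namespace SmoothConv

variable {l : Filter ℕ} {F : ℕ → ℝ → ℝ} {f : ℝ → ℝ}

lemma eventually_abs_le (h : SmoothConv l F f) (i : ℕ) {B : ℝ}
    (hB : ∀ t ∈ Set.Icc (0 : ℝ) 1, |iteratedDeriv i f t| < B) :
    ∀ᶠ n in l, ∀ t ∈ Set.Icc (0 : ℝ) 1, |iteratedDeriv i (F n) t| ≤ B := by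
  refine eventually_forall_of_forall_eventually_prod isCompact_Icc fun t ht => ?_
  filter_upwards [(h.tendsto i t).abs.eventually (eventually_lt_nhds (hB t ht))] with p hp
  exact hp.le

/-- Rescaled difference quotients of a convergent sequence converge to the derivative. -/
lemma differenceQuotient (h : SmoothConv l F f) (hl : l ≤ atTop) {b c : ℕ} (hbc : b ≠ c) :
    SmoothConv l (fun n t => (n : ℝ) / ((b : ℝ) - c) * (F n (t + b / n) - F n (t + c / n)))
      (deriv f) := by
  have hd : ContDiff ℝ ∞ (deriv f) := by
    have := h.smooth_lim
    fun_prop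
  have hs : ∀ n (b : ℕ), ContDiff ℝ ∞ fun t => F n (t + b / n) := fun n b =>
    (h.smooth n).comp (contDiff_id.add contDiff_const)
  refine ⟨fun n => contDiff_const.mul ((hs n b).sub (hs n c)), hd, fun i t => ?_⟩
  have hbc' : (b : ℝ) - c ≠ 0 := sub_ne_zero.2 (by exact_mod_cast hbc)
  -- The mean value theorem applied to the `i`-th derivative. As `ξ` tends to `t` along the product
  -- filter, the limit follows by composition. At `n = 0` any `ξ` within distance 0 will do.
  have key : ∀ p : ℕ × ℝ, ∃ ξ : ℝ, |ξ - p.2| ≤ ((b : ℝ) + c) / p.1 ∧ (0 < p.1 →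
      iteratedDeriv i (fun t => (p.1 : ℝ) / ((b : ℝ) - c) *
        (F p.1 (t + b / p.1) - F p.1 (t + c / p.1))) p.2 = iteratedDeriv (i + 1) (F p.1) ξ) := by
    rintro ⟨n, s⟩
    rcases Nat.eq_zero_or_pos n with rfl | hn
    · exact ⟨s, by simp, fun h => absurd h (lt_irrefl _)⟩
    have hn' : (0 : ℝ) < n := by exact_mod_cast hn
    set G := iteratedDeriv i (F n) with hG
    have hGd : Differentiable ℝ G := differentiable_iteratedDeriv_of_smooth (h.smooth n) i
    have hval : iteratedDeriv i (fun t => (n : ℝ) / ((b : ℝ) - c) *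
        (F n (t + b / n) - F n (t + c / n))) s
        = (n : ℝ) / ((b : ℝ) - c) * (G (s + b / n) - G (s + c / n)) := by
      rw [iteratedDeriv_const_mul_field, iteratedDeriv_fun_sub
        ((hs n b).contDiffAt.of_le (by exact_mod_cast le_top))
        ((hs n c).contDiffAt.of_le (by exact_mod_cast le_top)), iteratedDeriv_comp_add_const,
        iteratedDeriv_comp_add_const]
    have mvt : ∀ b c : ℕ, b < c → ∃ ξ : ℝ, |ξ - s| ≤ ((b : ℝ) + c) / n ∧
        (n : ℝ) / ((b : ℝ) - c) * (G (s + b / n) - G (s + c / n)) = deriv G ξ := by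
      intro b c hbc
      have hbc1 : (b : ℝ) < c := by exact_mod_cast hbc
      have hlt : s + (b : ℝ) / n < s + c / n := by gcongr
      obtain ⟨ξ, hξ, e⟩ := exists_deriv_eq_slope G hlt hGd.continuous.continuousOn
        hGd.differentiableOn
      refine ⟨ξ, ?_, ?_⟩
      · have hb0 : 0 ≤ (b : ℝ) / n := by positivity
        rw [abs_of_nonneg (by linarith [hξ.1]), add_div]
        linarith [hξ.2]
      · rw [e]
        have : s + (c : ℝ) / n - (s + b / n) = (c - b) / n := by ring
        rw [this]
        have h1 : (c : ℝ) - b ≠ 0 := by linarith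
        have h2 : (b : ℝ) - c ≠ 0 := by linarith
        field_simp
        ring
    rcases lt_or_gt_of_ne hbc with hlt | hlt
    · obtain ⟨ξ, h1, h2⟩ := mvt b c hlt
      exact ⟨ξ, h1, fun _ => by rw [hval, h2, iteratedDeriv_succ]⟩
    · obtain ⟨ξ, h1, h2⟩ := mvt c b hlt
      refine ⟨ξ, by rwa [add_comm (b : ℝ)], fun _ => ?_⟩
      rw [hval, iteratedDeriv_succ, ← h2, ← neg_sub (c : ℝ) b, ← neg_sub (G (s + c / n)),
        div_neg, neg_mul_neg]
  choose ξ hξ1 hξ2 using key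
  have hfst : Tendsto (fun p : ℕ × ℝ => p.1) (l ×ˢ 𝓝 t) l := tendsto_fst
  have hξt : Tendsto ξ (l ×ˢ 𝓝 t) (𝓝 t) := by
    have h1 : Tendsto (fun p : ℕ × ℝ => ((b : ℝ) + c) / p.1) (l ×ˢ 𝓝 t) (𝓝 0) :=
      (tendsto_const_div_atTop_nhds_zero_nat ((b : ℝ) + c)).comp (hfst.mono_right hl)
    have h2 : Tendsto (fun p => ξ p - p.2) (l ×ˢ 𝓝 t) (𝓝 0) :=
      squeeze_zero_norm (fun p => hξ1 p) h1
    simpa using h2.add (tendsto_snd : Tendsto (fun p : ℕ × ℝ => p.2) (l ×ˢ 𝓝 t) (𝓝 t))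
  have hlim := (h.tendsto (i + 1) t).comp (hfst.prodMk hξt)
  rw [iteratedDeriv_succ'] at hlim
  refine hlim.congr' ?_
  filter_upwards [(hfst.mono_right hl).eventually (eventually_gt_atTop 0)] with p hp
  exact (hξ2 p hp).symm

end SmoothConv

/-! ### The derivative test of order one -/

/-- Bundled conclusion of the derivative test of order `j`: exponential sums with phases
`a n • F n`, where `F` converges to a given `f` and `a n` lies between `A * n ^ (j - 1)` and
`o (n ^ j)`, are eventually at most `ε`, for suitable `A = A (f, ε)`. -/
def DerivativeTest (l : Filter ℕ) (j : ℕ) : Prop :=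
  ∀ f : ℝ → ℝ, (∀ᵐ t ∂volume.restrict (Set.Icc (0 : ℝ) 1), iteratedDeriv j f t ≠ 0) →
    ∀ ε > 0, ∃ A > 0, ∀ (F : ℕ → ℝ → ℝ) (a : ℕ → ℝ), SmoothConv l F f →
      Tendsto (fun n : ℕ => a n / (n : ℝ) ^ j) l (𝓝 0) →
      (∀ᶠ n : ℕ in l, A * (n : ℝ) ^ (j - 1) ≤ |a n|) →
      ∀ᶠ n in l, ‖expSum n (fun t => a n * F n t)‖ < ε

/-- If `g ≠ 0` almost everywhere, the weight `y² / (y² + δ)` at `y = g` is close to `1` in mean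
for small `δ`. -/
lemma exists_integral_weight_lt {g : ℝ → ℝ} (hg : Continuous g)
    (h0 : ∀ᵐ t ∂volume.restrict (Set.Icc (0 : ℝ) 1), g t ≠ 0) {ε : ℝ} (hε : 0 < ε) :
    ∃ δ > 0, ∫ t in (0 : ℝ)..1, δ / (g t ^ 2 + δ) < ε := by
  have h1 : ∀ᵐ t ∂(volume : Measure ℝ), t ∈ Set.uIoc (0 : ℝ) 1 → g t ≠ 0 := by
    rw [ae_restrict_iff' measurableSet_Icc] at h0
    filter_upwards [h0] with t ht ht'
    rw [Set.uIoc_of_le zero_le_one] at ht'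
    exact ht ⟨ht'.1.le, ht'.2⟩
  have h2 : Tendsto (fun δ : ℝ => ∫ t in (0 : ℝ)..1, δ / (g t ^ 2 + δ)) (𝓝[>] 0)
      (𝓝 (∫ _ in (0 : ℝ)..1, (0 : ℝ))) := by
    refine intervalIntegral.tendsto_integral_filter_of_dominated_convergence (fun _ => 1) ?_ ?_
      (intervalIntegrable_const) ?_
    · filter_upwards [self_mem_nhdsWithin] with δ hδ
      have hδ : 0 < δ := hδ
      refine Continuous.aestronglyMeasurable ?_
      exact continuous_const.div (by fun_prop) fun t => by positivity
    · filter_upwards [self_mem_nhdsWithin] with δ hδ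
      have hδ : 0 < δ := hδ
      refine ae_of_all _ fun t _ => ?_
      rw [Real.norm_of_nonneg (by positivity), div_le_one (by positivity)]
      nlinarith [sq_nonneg (g t)]
    · filter_upwards [h1] with t ht ht'
      have hgt := ht ht'
      have : Tendsto (fun δ : ℝ => δ / (g t ^ 2 + δ)) (𝓝 0) (𝓝 (0 / (g t ^ 2 + 0))) := by
        refine Tendsto.div tendsto_id (tendsto_const_nhds.add tendsto_id) (by positivity)
      simp only [zero_div] at this
      exact this.mono_left nhdsWithin_le_nhds
  simp only [intervalIntegral.integral_zero] at h2
  obtain ⟨δ, h3, h4⟩ := ((h2.eventually (eventually_lt_nhds hε)).and self_mem_nhdsWithin).exists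
  exact ⟨δ, h4, h3⟩

lemma derivativeTest_one {l : Filter ℕ} (hl : l ≤ atTop) : DerivativeTest l 1 := by
  intro f hf ε hε
  -- `DerivativeTest` allows arbitrary `f`; without smoothness no `F` can converge to it and the
  -- claim is vacuous.
  by_cases hfs : ContDiff ℝ ∞ f
  swap
  · exact ⟨1, one_pos, fun F a h => absurd h.smooth_lim hfs⟩
  have hfc := continuous_iteratedDeriv_of_smooth hfs
  obtain ⟨δ, hδ, hint⟩ := exists_integral_weight_lt (hfc 1) hf (by positivity : 0 < ε / 8)
  have hbd : ∀ i, ∃ B : ℝ, 0 < B ∧ ∀ t ∈ Set.Icc (0 : ℝ) 1, |iteratedDeriv i f t| < B := by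
    intro i
    obtain ⟨C, hC⟩ := isCompact_Icc.exists_bound_of_continuousOn (hfc i).continuousOn
    refine ⟨|C| + 1, by positivity, fun t ht => ?_⟩
    have := hC t ht
    rw [Real.norm_eq_abs] at this
    linarith [le_abs_self C]
  obtain ⟨B₁, hB₁, hf₁⟩ := hbd 1
  obtain ⟨B₂, hB₂, hf₂⟩ := hbd 2
  -- This constant brings the integrated-by-parts term down to `ε / 8`. The complementary weight
  -- costs `ε / 4` and the Riemann sum error `ε / 2`.
  refine ⟨8 * ((2 * B₁ + B₂) / δ) / ε, by positivity, fun F a h ha hA => ?_⟩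
  have hw : ∀ᶠ n in l, ∀ t ∈ Set.Icc (0 : ℝ) 1,
      δ / (iteratedDeriv 1 (F n) t ^ 2 + δ) ≤ δ / (iteratedDeriv 1 f t ^ 2 + δ) + ε / 8 := by
    refine eventually_forall_of_forall_eventually_prod isCompact_Icc fun t _ => ?_
    have h1 : Tendsto (fun p : ℕ × ℝ => δ / (iteratedDeriv 1 (F p.1) p.2 ^ 2 + δ)
        - (δ / (iteratedDeriv 1 f p.2 ^ 2 + δ))) (l ×ˢ 𝓝 t)
        (𝓝 (δ / (iteratedDeriv 1 f t ^ 2 + δ) - δ / (iteratedDeriv 1 f t ^ 2 + δ))) := by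
      refine Tendsto.sub ?_ ?_
      · exact tendsto_const_nhds.div (((h.tendsto 1 t).pow 2).add_const δ) (by positivity)
      · have h2 : Tendsto (fun p : ℕ × ℝ => iteratedDeriv 1 f p.2) (l ×ˢ 𝓝 t)
            (𝓝 (iteratedDeriv 1 f t)) := ((hfc 1).tendsto t).comp tendsto_snd
        exact tendsto_const_nhds.div ((h2.pow 2).add_const δ) (by positivity)
    rw [sub_self] at h1
    filter_upwards [h1.eventually (eventually_lt_nhds (by positivity : 0 < ε / 8))] with p hp
    linarith
  have hR : ∀ᶠ n in l, 2 * Real.pi * B₁ * |a n / (n : ℝ) ^ 1| < ε / 2 := by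
    have h1 : Tendsto (fun n => 2 * Real.pi * B₁ * |a n / (n : ℝ) ^ 1|) l
        (𝓝 (2 * Real.pi * B₁ * |0|)) := ha.abs.const_mul _
    rw [abs_zero, mul_zero] at h1
    exact h1.eventually (eventually_lt_nhds (by positivity))
  filter_upwards [hw, hR, hA, h.eventually_abs_le 1 hf₁, h.eventually_abs_le 2 hf₂,
    hl (eventually_gt_atTop 0)] with n hwn hRn hAn h₁ h₂ hn
  have hn' : (0 : ℝ) < n := by exact_mod_cast hn
  have hFc : Continuous (F n) := (h.smooth n).continuous
  have hpc : Continuous (iteratedDeriv 1 (F n)) :=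
    continuous_iteratedDeriv_of_smooth (h.smooth n) 1
  have hapos : 0 < |a n| := lt_of_lt_of_le (by simp; positivity) hAn
  have hgc : Continuous fun t => phase (a n * F n t) := continuous_phase.comp (by fun_prop)
  have hLip : ∀ s ∈ Set.Icc (0 : ℝ) 1, ∀ t ∈ Set.Icc (0 : ℝ) 1,
      ‖phase (a n * F n s) - phase (a n * F n t)‖ ≤ 2 * Real.pi * B₁ * |a n| * |s - t| := by
    intro s hs t ht
    have h3 := (convex_Icc (0 : ℝ) 1).norm_image_sub_le_of_norm_deriv_le (f := F n) (C := B₁)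
      (fun y _ => (h.smooth n).differentiable (by simp) y)
      (fun y hy => by simpa [iteratedDeriv_one] using h₁ y hy) ht hs
    rw [Real.norm_eq_abs, Real.norm_eq_abs] at h3
    refine (norm_phase_sub_phase_le _ _).trans ?_
    rw [← mul_sub, abs_mul]
    calc 2 * Real.pi * (|a n| * |F n s - F n t|)
        ≤ 2 * Real.pi * (|a n| * (B₁ * |s - t|)) := by
          have := Real.pi_pos
          gcongr
      _ = _ := by ring
  have hsum := norm_riemann_sum_sub_integral_le hgc hLip
    (by have := Real.pi_pos; positivity) hn
  have hmain := norm_integral_weight_mul_phase_le (h.smooth n) hδ (abs_pos.1 hapos) h₁ h₂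
  have hmain' : (2 * B₁ + B₂) / δ / |a n| ≤ ε / 8 := by
    rw [div_le_iff₀ hapos]
    simp only [tsub_self, pow_zero, mul_one] at hAn
    rw [div_le_iff₀ hε] at hAn
    linarith
  have hposn : ∀ t, 0 < iteratedDeriv 1 (F n) t ^ 2 + δ := fun t => by positivity
  have hwc : Continuous fun t => δ / (iteratedDeriv 1 (F n) t ^ 2 + δ) :=
    continuous_const.div (by fun_prop) fun t => (hposn t).ne'
  have hfwc : Continuous fun t => δ / (iteratedDeriv 1 f t ^ 2 + δ) := by
    have := hfc 1
    exact continuous_const.div (by fun_prop) fun t => by positivity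
  have hwc2 : Continuous fun t => iteratedDeriv 1 (F n) t ^ 2 / (iteratedDeriv 1 (F n) t ^ 2 + δ) :=
    Continuous.div (by fun_prop) (by fun_prop) fun t => (hposn t).ne'
  have hrest : ‖∫ t in (0 : ℝ)..1, ((δ / (iteratedDeriv 1 (F n) t ^ 2 + δ) : ℝ) : ℂ) *
      phase (a n * F n t)‖ < ε / 4 := by
    have e1 : ‖∫ t in (0 : ℝ)..1, ((δ / (iteratedDeriv 1 (F n) t ^ 2 + δ) : ℝ) : ℂ) *
        phase (a n * F n t)‖ ≤ ∫ t in (0 : ℝ)..1, (δ / (iteratedDeriv 1 f t ^ 2 + δ) + ε / 8) := by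
      refine intervalIntegral.norm_integral_le_of_norm_le zero_le_one (ae_of_all _ fun t ht => ?_)
        ((hfwc.add continuous_const).intervalIntegrable _ _)
      rw [norm_mul, norm_phase, mul_one, Complex.norm_real,
        Real.norm_of_nonneg (by have := hposn t; positivity)]
      exact hwn t ⟨ht.1.le, ht.2⟩
    rw [intervalIntegral.integral_add (hfwc.intervalIntegrable _ _) intervalIntegrable_const] at e1
    simp only [intervalIntegral.integral_const, sub_zero, one_smul] at e1
    linarith
  have hsplit : ∫ t in (0 : ℝ)..1, phase (a n * F n t)
      = (∫ t in (0 : ℝ)..1, ((iteratedDeriv 1 (F n) t ^ 2 /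
          (iteratedDeriv 1 (F n) t ^ 2 + δ) : ℝ) : ℂ) * phase (a n * F n t))
        + ∫ t in (0 : ℝ)..1, ((δ / (iteratedDeriv 1 (F n) t ^ 2 + δ) : ℝ) : ℂ) *
          phase (a n * F n t) := by
    have hc1 : Continuous fun t => ((iteratedDeriv 1 (F n) t ^ 2 /
        (iteratedDeriv 1 (F n) t ^ 2 + δ) : ℝ) : ℂ) * phase (a n * F n t) :=
      (Complex.continuous_ofReal.comp hwc2).mul hgc
    have hc2 : Continuous fun t => ((δ / (iteratedDeriv 1 (F n) t ^ 2 + δ) : ℝ) : ℂ) *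
        phase (a n * F n t) := (Complex.continuous_ofReal.comp hwc).mul hgc
    rw [← intervalIntegral.integral_add (hc1.intervalIntegrable _ _) (hc2.intervalIntegrable _ _)]
    congr 1
    ext t
    rw [← add_mul, ← Complex.ofReal_add, ← add_div, div_self (hposn t).ne', Complex.ofReal_one,
      one_mul]
  have hI : ‖∫ t in (0 : ℝ)..1, phase (a n * F n t)‖ < ε / 8 + ε / 4 := by
    rw [hsplit]
    exact (norm_add_le _ _).trans_lt (add_lt_add_of_le_of_lt (hmain.trans hmain') hrest)
  have hK : 2 * Real.pi * B₁ * |a n| / n < ε / 2 := by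
    rwa [pow_one, abs_div, abs_of_pos hn', ← mul_div_assoc] at hRn
  have := norm_le_norm_add_norm_sub' (expSum n (fun t => a n * F n t))
    (∫ t in (0 : ℝ)..1, phase (a n * F n t))
  rw [expSum] at this ⊢
  linarith

/-! ### Van der Corput's inequality and Weyl differencing -/

/-- Each unit shift telescopes to two boundary terms of norm at most 1. -/
lemma norm_sum_sub_sum_shift_le {u : ℕ → ℂ} (hu : ∀ k, ‖u k‖ ≤ 1) (n h : ℕ) :
    ‖∑ k ∈ Finset.Icc 1 n, u k - ∑ k ∈ Finset.Icc 1 n, u (k + h)‖ ≤ 2 * h := by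
  induction h with
  | zero => simp
  | succ h ih =>
    have h1 : ∑ k ∈ Finset.Icc 1 n, u (k + h) - ∑ k ∈ Finset.Icc 1 n, u (k + (h + 1))
        = u (1 + h) - u (n + 1 + h) := by
      rw [← Finset.sum_sub_distrib]
      have h3 : Finset.Icc 1 n = Finset.Ico 1 (n + 1) := rfl
      rw [h3]
      have := Finset.sum_Ico_sub (fun k => - u (k + h)) (by omega : 1 ≤ n + 1)
      rw [show u (1 + h) - u (n + 1 + h) = - u (n + 1 + h) - - u (1 + h) by ring, ← this]
      refine Finset.sum_congr rfl fun k _ => ?_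
      rw [show k + (h + 1) = k + 1 + h by omega]
      ring
    have h2 : ‖u (1 + h) - u (n + 1 + h)‖ ≤ 2 :=
      (norm_sub_le _ _).trans (by linarith [hu (1 + h), hu (n + 1 + h)])
    have h3 := norm_sub_le_norm_sub_add_norm_sub (∑ k ∈ Finset.Icc 1 n, u k)
      (∑ k ∈ Finset.Icc 1 n, u (k + h)) (∑ k ∈ Finset.Icc 1 n, u (k + (h + 1)))
    rw [h1] at h3
    push_cast
    linarith

/-- A form of van der Corput's inequality. -/
lemma norm_average_le_of_correlations {u : ℕ → ℂ} (hu : ∀ k, ‖u k‖ ≤ 1) {n H : ℕ} (hn : 0 < n)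
    (hH : 0 < H) {C : ℝ}
    (hC : ∑ p ∈ Finset.range H ×ˢ Finset.range H,
      ‖(n : ℂ)⁻¹ * ∑ k ∈ Finset.Icc 1 n, u (k + p.1) * (starRingEnd ℂ) (u (k + p.2))‖
        ≤ C * H ^ 2) :
    ‖(n : ℂ)⁻¹ * ∑ k ∈ Finset.Icc 1 n, u k‖ ≤ Real.sqrt C + 2 * H / n := by
  have hn' : (0 : ℝ) < n := by exact_mod_cast hn
  have hH' : (0 : ℝ) < H := by exact_mod_cast hH
  -- Averaging over `H` shifts changes the sum little. Cauchy–Schwarz then leads to the sum of `‖v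
  -- k‖ ^ 2`, which expands into the correlations.
  set v : ℕ → ℂ := fun k => ∑ h ∈ Finset.range H, u (k + h) with hv
  have h1 : ‖(H : ℂ) * ∑ k ∈ Finset.Icc 1 n, u k - ∑ k ∈ Finset.Icc 1 n, v k‖ ≤ 2 * H * H := by
    have e : (H : ℂ) * ∑ k ∈ Finset.Icc 1 n, u k - ∑ k ∈ Finset.Icc 1 n, v k
        = ∑ h ∈ Finset.range H,
          (∑ k ∈ Finset.Icc 1 n, u k - ∑ k ∈ Finset.Icc 1 n, u (k + h)) := by
      rw [Finset.sum_sub_distrib, Finset.sum_const, Finset.card_range, nsmul_eq_mul, hv,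
        Finset.sum_comm]
    rw [e]
    refine (norm_sum_le_of_le _ fun h hh => (norm_sum_sub_sum_shift_le hu n h).trans
      (?_ : 2 * (h : ℝ) ≤ 2 * H)).trans ?_
    · have : (h : ℝ) ≤ H := by exact_mod_cast (Finset.mem_range.1 hh).le
      linarith
    · simp only [Finset.sum_const, Finset.card_range, nsmul_eq_mul]
      linarith
  have h2 : ∑ k ∈ Finset.Icc 1 n, ‖v k‖ ^ 2 ≤ C * H ^ 2 * n := by
    have e : ((∑ k ∈ Finset.Icc 1 n, ‖v k‖ ^ 2 : ℝ) : ℂ)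
        = ∑ p ∈ Finset.range H ×ˢ Finset.range H,
          ∑ k ∈ Finset.Icc 1 n, u (k + p.1) * (starRingEnd ℂ) (u (k + p.2)) := by
      rw [Finset.sum_comm]
      push_cast
      refine Finset.sum_congr rfl fun k _ => ?_
      rw [← Complex.mul_conj', hv]
      simp only [map_sum]
      rw [Finset.sum_mul_sum, Finset.sum_product]
    have e2 : ∑ k ∈ Finset.Icc 1 n, ‖v k‖ ^ 2
        = ‖((∑ k ∈ Finset.Icc 1 n, ‖v k‖ ^ 2 : ℝ) : ℂ)‖ := by
      rw [Complex.norm_real, Real.norm_of_nonneg (Finset.sum_nonneg fun _ _ => by positivity)]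
    rw [e2, e]
    refine (norm_sum_le _ _).trans ?_
    have e3 : ∀ z : ℂ, ‖(n : ℂ)⁻¹ * z‖ = (n : ℝ)⁻¹ * ‖z‖ := fun z => by
      rw [norm_mul, norm_inv, Complex.norm_natCast]
    simp only [e3] at hC
    rw [← Finset.mul_sum, inv_mul_le_iff₀ hn'] at hC
    linarith
  have h3 : (∑ k ∈ Finset.Icc 1 n, ‖v k‖) ^ 2 ≤ C * (H * n) ^ 2 := by
    have := sq_sum_le_card_mul_sum_sq (s := Finset.Icc 1 n) (f := fun k => ‖v k‖)
    simp only [Nat.card_Icc, add_tsub_cancel_right] at this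
    nlinarith
  have h4 : ∑ k ∈ Finset.Icc 1 n, ‖v k‖ ≤ Real.sqrt C * (H * n) := by
    have h5 := Real.sqrt_le_sqrt h3
    rwa [Real.sqrt_sq (Finset.sum_nonneg fun _ _ => norm_nonneg _), mul_comm C,
      Real.sqrt_mul (by positivity), Real.sqrt_sq (by positivity), mul_comm] at h5
  have h6 : (H : ℝ) * ‖∑ k ∈ Finset.Icc 1 n, u k‖ ≤ Real.sqrt C * (H * n) + 2 * H * H := by
    have h7 := norm_le_norm_add_norm_sub' ((H : ℂ) * ∑ k ∈ Finset.Icc 1 n, u k)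
      (∑ k ∈ Finset.Icc 1 n, v k)
    rw [norm_mul, Complex.norm_natCast] at h7
    linarith [norm_sum_le (Finset.Icc 1 n) v]
  rw [norm_mul, norm_inv, Complex.norm_natCast, inv_mul_le_iff₀ hn']
  have e : (n : ℝ) * (Real.sqrt C + 2 * H / n) = Real.sqrt C * n + 2 * H := by
    field_simp
  rw [e]
  nlinarith

/-- Pairs in a square which are close to the diagonal are few. -/
lemma card_near_diagonal_le (H D : ℕ) :
    (((Finset.range H ×ˢ Finset.range H).filter
      fun p => p.1 < p.2 + D ∧ p.2 < p.1 + D).card : ℝ) ≤ 2 * D * H := by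
  have h1 : ((Finset.range H ×ˢ Finset.range H).filter
      fun p => p.1 < p.2 + D ∧ p.2 < p.1 + D) ⊆
      (Finset.range H ×ˢ Finset.range (2 * D)).image fun q => (q.1, q.1 + q.2 - D) := by
    rintro ⟨a, b⟩ h
    simp only [Finset.mem_filter, Finset.mem_product, Finset.mem_range, Finset.mem_image,
      Prod.exists, Prod.mk.injEq] at h ⊢
    exact ⟨a, b + D - a, by omega, rfl, by omega⟩
  have h2 := (Finset.card_le_card h1).trans Finset.card_image_le
  rw [Finset.card_product, Finset.card_range, Finset.card_range] at h2
  calc _ ≤ ((H * (2 * D) : ℕ) : ℝ) := by exact_mod_cast h2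
    _ = _ := by push_cast; ring

/-- Weyl differencing. In the conclusion the lower bound on `a` may have any constant. -/
lemma DerivativeTest.succ {l : Filter ℕ} (hl : l ≤ atTop) {j : ℕ} (hj : 1 ≤ j)
    (hT : DerivativeTest l j) {f : ℝ → ℝ}
    (hf : ∀ᵐ t ∂volume.restrict (Set.Icc (0 : ℝ) 1), iteratedDeriv (j + 1) f t ≠ 0)
    {c : ℝ} (hc : 0 < c) {F : ℕ → ℝ → ℝ} {a : ℕ → ℝ} (hF : SmoothConv l F f)
    (ha : Tendsto (fun n : ℕ => a n / (n : ℝ) ^ (j + 1)) l (𝓝 0))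
    (hac : ∀ᶠ n : ℕ in l, c * (n : ℝ) ^ j ≤ |a n|) {ε : ℝ} (hε : 0 < ε) :
    ∀ᶠ n : ℕ in l, ‖expSum n (fun t => a n * F n t)‖ < ε := by
  -- Far pairs and near-diagonal pairs each contribute at most `η * H ^ 2`, and `√(2η) = ε / 2`; the
  -- shift error takes the other half.
  set η : ℝ := ε ^ 2 / 8 with hη
  have hη0 : 0 < η := by positivity
  obtain ⟨A, hA, hTA⟩ := hT (deriv f) (by simpa only [← iteratedDeriv_succ'] using hf) η hη0
  -- Pairs at distance at least `D` have amplitude constant at least `D * c ≥ A`. The choice of `H`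
  -- keeps the `2 * D * H` closer pairs below `η * H ^ 2`.
  obtain ⟨D, hD⟩ := exists_nat_gt (A / c)
  obtain ⟨H, hH⟩ := exists_nat_gt (2 * D / η)
  have hD0 : (0 : ℝ) < D := lt_trans (by positivity) hD
  have hH0 : (0 : ℝ) < H := lt_trans (by positivity) hH
  have hHpos : 0 < H := by exact_mod_cast hH0
  have hpair : ∀ p ∈ Finset.range H ×ˢ Finset.range H, ¬ (p.1 < p.2 + D ∧ p.2 < p.1 + D) →
      ∀ᶠ n : ℕ in l, ‖(n : ℂ)⁻¹ * ∑ k ∈ Finset.Icc 1 n,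
        phase (a n * F n (((k + p.1 : ℕ) : ℝ) / n)) *
        (starRingEnd ℂ) (phase (a n * F n (((k + p.2 : ℕ) : ℝ) / n)))‖ < η := by
    rintro ⟨b, d⟩ - hbd
    simp only at hbd ⊢
    have hDpos : 0 < D := by exact_mod_cast hD0
    have hne : b ≠ d := by rintro rfl; omega
    have hne' : (b : ℝ) - d ≠ 0 := sub_ne_zero.2 (by exact_mod_cast hne)
    have hdist : (D : ℝ) ≤ |(b : ℝ) - d| := by
      rw [le_abs]
      by_cases h : b < d + D
      · right
        have : (b : ℝ) + D ≤ d := by exact_mod_cast (by omega : b + D ≤ d)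
        linarith
      · left
        have : (d : ℝ) + D ≤ b := by exact_mod_cast (by omega : d + D ≤ b)
        linarith
    have h1 := hTA _ (fun n => ((b : ℝ) - d) * a n / n) (hF.differenceQuotient hl hne) ?_ ?_
    · filter_upwards [h1, hl (eventually_gt_atTop 0)] with n hn hn0
      have hn' : (n : ℝ) ≠ 0 := by exact_mod_cast hn0.ne'
      refine lt_of_eq_of_lt ?_ hn
      rw [expSum]
      congr 2
      refine Finset.sum_congr rfl fun k _ => ?_
      rw [conj_phase, ← phase_add]
      congr 1
      push_cast
      rw [add_div, add_div]
      field_simp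
      ring
    · have h2 := ha.const_mul ((b : ℝ) - d)
      rw [mul_zero] at h2
      refine h2.congr' ?_
      filter_upwards with n
      rw [pow_succ', div_div, mul_div_assoc]
    · filter_upwards [hac, hl (eventually_gt_atTop 0)] with n hn hn0
      have hn' : (0 : ℝ) < n := by exact_mod_cast hn0
      rw [abs_div, abs_of_pos hn', le_div_iff₀ hn', abs_mul, mul_assoc, ← pow_succ,
        Nat.sub_add_cancel hj]
      have hA' : A ≤ D * c := ((div_lt_iff₀ hc).1 hD).le
      calc A * (n : ℝ) ^ j ≤ D * c * (n : ℝ) ^ j := by gcongr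
        _ = D * (c * (n : ℝ) ^ j) := by ring
        _ ≤ |(b : ℝ) - d| * |a n| := by gcongr
  have hall : ∀ᶠ n : ℕ in l, ∀ p ∈ Finset.range H ×ˢ Finset.range H,
      ¬ (p.1 < p.2 + D ∧ p.2 < p.1 + D) → ‖(n : ℂ)⁻¹ * ∑ k ∈ Finset.Icc 1 n,
        phase (a n * F n (((k + p.1 : ℕ) : ℝ) / n)) *
        (starRingEnd ℂ) (phase (a n * F n (((k + p.2 : ℕ) : ℝ) / n)))‖ < η := by
    rw [eventually_all_finset]
    intro p hp
    by_cases h : p.1 < p.2 + D ∧ p.2 < p.1 + D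
    · exact Eventually.of_forall fun n h' => absurd h h'
    · filter_upwards [hpair p hp h] with n hn _ using hn
  have hsmall : ∀ᶠ n : ℕ in l, 2 * (H : ℝ) / n < ε / 2 :=
    hl ((tendsto_const_div_atTop_nhds_zero_nat (2 * (H : ℝ))).eventually
      (eventually_lt_nhds (by positivity)))
  filter_upwards [hall, hsmall, hl (eventually_gt_atTop 0)] with n hn hns hn0
  have hn' : (0 : ℝ) < n := by exact_mod_cast hn0
  have hvdc := norm_average_le_of_correlations (u := fun k => phase (a n * F n ((k : ℝ) / n)))
    (fun k => (norm_phase _).le) hn0 hHpos (C := 2 * η) ?_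
  · have hs : Real.sqrt (2 * η) = ε / 2 := by
      rw [show 2 * η = (ε / 2) ^ 2 by rw [hη]; ring, Real.sqrt_sq (by positivity)]
    rw [hs] at hvdc
    refine lt_of_le_of_lt hvdc ?_
    linarith
  · have hle : ∀ p ∈ Finset.range H ×ˢ Finset.range H, ‖(n : ℂ)⁻¹ * ∑ k ∈ Finset.Icc 1 n,
        phase (a n * F n (((k + p.1 : ℕ) : ℝ) / n)) *
        (starRingEnd ℂ) (phase (a n * F n (((k + p.2 : ℕ) : ℝ) / n)))‖
        ≤ η + if p.1 < p.2 + D ∧ p.2 < p.1 + D then 1 else 0 := by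
      intro p hp
      split_ifs with h
      · refine le_trans ?_ (le_add_of_nonneg_left hη0.le)
        rw [norm_mul, norm_inv, Complex.norm_natCast, inv_mul_le_one₀ hn']
        refine (norm_sum_le _ _).trans ?_
        simp [norm_phase]
      · rw [add_zero]
        exact (hn p hp h).le
    refine (Finset.sum_le_sum hle).trans ?_
    rw [Finset.sum_add_distrib, Finset.sum_const, Finset.card_product, Finset.card_range,
      nsmul_eq_mul, Finset.sum_boole]
    have h3 := card_near_diagonal_le H D
    rw [div_lt_iff₀ hη0] at hH
    push_cast
    nlinarith

lemma derivativeTest {l : Filter ℕ} (hl : l ≤ atTop) (j : ℕ) : DerivativeTest l (j + 1) := by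
  induction j with
  | zero => exact derivativeTest_one hl
  | succ j ih =>
    intro f hf ε hε
    exact ⟨1, one_pos, fun F a hF ha hac => ih.succ hl (by omega) hf one_pos hF ha hac hε⟩

/-! ### Weyl's criterion on the torus -/

section Weyl

/-- Translation by half a period changes the sign of the character but not its integral. -/
lemma integral_fourier_eq_zero {n : ℤ} (hn : n ≠ 0) :
    ∫ z : UnitAddCircle, fourier n z = 0 :=
  integral_eq_zero_of_add_right_eq_neg (fourier_add_half_inv_index hn one_pos)

lemma isProbabilityMeasure_volume_torus (d : ℕ) :
    IsProbabilityMeasure (volume : Measure (UnitAddTorus (Fin d))) := by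
  have : IsProbabilityMeasure (volume : Measure UnitAddCircle) :=
    ⟨by rw [AddCircle.measure_univ, ENNReal.ofReal_one]⟩
  infer_instance

lemma integral_mFourier_eq_zero {d : ℕ} {h : Fin d → ℤ} (hh : h ≠ 0) :
    ∫ z : UnitAddTorus (Fin d), UnitAddTorus.mFourier h z = 0 := by
  rw [UnitAddTorus.mFourier, ContinuousMap.coe_mk, integral_fintype_prod_volume_eq_prod]
  obtain ⟨i, hi⟩ := Function.ne_iff.mp hh
  exact Finset.prod_eq_zero (Finset.mem_univ i) (integral_fourier_eq_zero hi)

lemma mFourier_torusProj {d : ℕ} (h : Fin d → ℤ) (v : Fin d → ℝ) :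
    UnitAddTorus.mFourier h (torusProj v) = phase (∑ i, (h i : ℝ) * v i) := by
  simp only [UnitAddTorus.mFourier, ContinuousMap.coe_mk, torusProj, fourier_coe_apply, phase]
  rw [← Complex.exp_sum, Finset.mul_sum]
  push_cast
  rw [Finset.sum_mul]
  congr 1
  refine Finset.sum_congr rfl fun i _ => ?_
  ring

lemma integral_countingMeasure {d : ℕ} (γ : ℝ → (Fin d → ℝ)) (n : ℕ)
    (f : C(UnitAddTorus (Fin d), ℂ)) :
    ∫ z, f z ∂(countingMeasure γ n)
      = (n : ℂ)⁻¹ * ∑ k ∈ Finset.Icc 1 n, f (torusProj (γ ((k : ℝ) / n))) := by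
  rw [countingMeasure, integral_smul_measure, integral_finsetSum_measure]
  · simp only [integral_dirac, ENNReal.toReal_inv, ENNReal.toReal_natCast, Complex.real_smul]
    push_cast
    rfl
  · intro k _
    exact integrable_dirac (by simp)

lemma norm_integral_countingMeasure_le {d : ℕ} (γ : ℝ → (Fin d → ℝ)) (n : ℕ)
    (f : C(UnitAddTorus (Fin d), ℂ)) :
    ‖∫ z, f z ∂(countingMeasure γ n)‖ ≤ ‖f‖ := by
  rw [integral_countingMeasure, norm_mul, norm_inv, Complex.norm_natCast]
  have h : ‖∑ k ∈ Finset.Icc 1 n, f (torusProj (γ ((k : ℝ) / n)))‖ ≤ n * ‖f‖ := by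
    refine (norm_sum_le_of_le _ fun k _ => f.norm_coe_le_norm _).trans ?_
    simp
  rcases Nat.eq_zero_or_pos n with rfl | hn
  · simp
  · rwa [inv_mul_le_iff₀ (by exact_mod_cast hn)]

/-- Weyl's criterion on the torus. -/
lemma equidistributes_of_expSum {d : ℕ} (γ : ℕ → ℝ → (Fin d → ℝ))
    (hγ : ∀ h : Fin d → ℤ, h ≠ 0 →
      Tendsto (fun n => expSum n (fun t => ∑ i, (h i : ℝ) * γ n t i)) atTop (𝓝 0)) :
    Equidistributes (fun n => countingMeasure (γ n) n) := by
  have := isProbabilityMeasure_volume_torus d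
  have hint : ∀ f : C(UnitAddTorus (Fin d), ℂ), Integrable (fun z => f z) volume := fun f =>
    f.continuous.integrable_of_hasCompactSupport (HasCompactSupport.of_compactSpace _)
  have hintc : ∀ n (f : C(UnitAddTorus (Fin d), ℂ)),
      Integrable (fun z => f z) (countingMeasure (γ n) n) := fun n f => by
    -- For `n = 0` the scalar is `∞`, but the sum is empty and the measure is 0.
    rcases Nat.eq_zero_or_pos n with rfl | hn
    · simp [countingMeasure]
    refine Integrable.smul_measure ?_ (by simp [hn.ne'])
    rw [integrable_finsetSum_measure]
    exact fun k _ => integrable_dirac (by simp)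
  have hspan : ∀ f ∈ Submodule.span ℂ (Set.range (UnitAddTorus.mFourier (d := Fin d))),
      Tendsto (fun n => ∫ z, f z ∂(countingMeasure (γ n) n)) atTop (𝓝 (∫ z, f z)) := by
    intro f hf
    induction hf using Submodule.span_induction with
    | mem f hf =>
      obtain ⟨h, rfl⟩ := hf
      by_cases hh : h = 0
      · subst hh
        simp only [UnitAddTorus.mFourier_zero, ContinuousMap.one_apply, integral_const,
          probReal_univ, one_smul]
        refine tendsto_const_nhds.congr' ?_
        filter_upwards [eventually_gt_atTop 0] with n hn
        have : (n : ℂ) ≠ 0 := by exact_mod_cast hn.ne'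
        simpa [this] using (integral_countingMeasure (γ n) n 1).symm
      · rw [integral_mFourier_eq_zero hh]
        refine (hγ h hh).congr fun n => ?_
        simp only [integral_countingMeasure, mFourier_torusProj, expSum]
    | zero => simp
    | add f g _ _ hf hg =>
      simp only [ContinuousMap.add_apply]
      rw [integral_add (hint f) (hint g)]
      refine (hf.add hg).congr fun n => ?_
      rw [integral_add (hintc n f) (hintc n g)]
    | smul c f _ hf =>
      simp only [ContinuousMap.smul_apply, integral_smul]
      exact hf.const_smul c
  intro f
  have hf : f ∈ closure (Submodule.span ℂ (Set.range (UnitAddTorus.mFourier (d := Fin d))) :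
      Set C(UnitAddTorus (Fin d), ℂ)) := by
    rw [← Submodule.topologicalClosure_coe, UnitAddTorus.span_mFourier_closure_eq_top]
    trivial
  rw [Metric.tendsto_atTop]
  intro ε hε
  obtain ⟨g, hg, hfg⟩ := Metric.mem_closure_iff.1 hf (ε / 3) (by positivity)
  obtain ⟨N, hN⟩ := Metric.tendsto_atTop.1 (hspan g hg) (ε / 3) (by positivity)
  refine ⟨N, fun n hn => ?_⟩
  have h1 : dist (∫ z, f z ∂(countingMeasure (γ n) n)) (∫ z, g z ∂(countingMeasure (γ n) n))
      < ε / 3 := by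
    rw [dist_eq_norm, ← integral_sub (hintc n f) (hintc n g)]
    refine lt_of_le_of_lt (norm_integral_countingMeasure_le (γ n) n (f - g)) ?_
    rwa [← dist_eq_norm]
  have h2 : dist (∫ z, g z) (∫ z, f z) < ε / 3 := by
    rw [dist_comm, dist_eq_norm, ← integral_sub (hint f) (hint g)]
    have h3 := norm_integral_le_of_norm_le_const (μ := (volume : Measure (UnitAddTorus (Fin d))))
      (ae_of_all _ fun z => (f - g).norm_coe_le_norm z)
    rw [probReal_univ, mul_one] at h3
    refine lt_of_le_of_lt h3 ?_
    rwa [← dist_eq_norm]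
  calc _ ≤ _ + _ + _ := dist_triangle4 _ _ _ _
    _ < ε / 3 + ε / 3 + ε / 3 := add_lt_add (add_lt_add h1 (hN n hn)) h2
    _ = ε := by ring

end Weyl

/-! ### Smooth extension and dependence on the parameter -/

section Smooth

variable {E : Type*} [NormedAddCommGroup E] [NormedSpace ℝ E]

/-- A function which is analytic near a compact set agrees on that set with a globally smooth
function. -/
lemma exists_contDiff_eqOn [FiniteDimensional ℝ E] {W : Type*} [NormedAddCommGroup W]
    [NormedSpace ℝ W] [CompleteSpace W] {ψ : E → W} {K : Set E} (hK : IsClosed K)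
    (hψ : AnalyticOnNhd ℝ ψ K) : ∃ Ψ : E → W, ContDiff ℝ ∞ Ψ ∧ Set.EqOn Ψ ψ K := by
  have hopen := isOpen_analyticAt ℝ ψ
  -- The cutoff is 1 near `K` and 0 near the complement of the open set where `ψ` is analytic.
  obtain ⟨χ, h0, h1, -⟩ := exists_contMDiffMap_zero_one_nhds_of_isClosed
    (modelWithCornersSelf ℝ E) (n := ⊤) hopen.isClosed_compl hK
    (Set.disjoint_left.2 fun x hx hxK => hx (hψ x hxK))
  refine ⟨fun x => χ x • ψ x, contDiff_iff_contDiffAt.2 fun x => ?_, fun x hx => ?_⟩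
  · by_cases hx : AnalyticAt ℝ ψ x
    · exact (χ.contMDiff.contDiff.contDiffAt).smul hx.contDiffAt
    · have h2 : ∀ᶠ y in 𝓝 x, χ y = 0 := h0.filter_mono (nhds_le_nhdsSet hx)
      have h3 : (fun y => χ y • ψ y) =ᶠ[𝓝 x] fun _ => 0 := by
        filter_upwards [h2] with y hy
        rw [hy, zero_smul]
      exact contDiffAt_const.congr_of_eventuallyEq h3
  · have : χ x = 1 := (h1.filter_mono (nhds_le_nhdsSet hx)).self_of_nhds
    simp only [this, one_smul]

/-- The `t`-derivative of `Φ` is the smooth function `p ↦ fderiv ℝ Φ p (0, 1)`, to which the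
induction hypothesis applies; hence the quantification over `Φ`. -/
lemma continuous_iteratedDeriv_partial (i : ℕ) : ∀ {Φ : E × ℝ → ℝ}, ContDiff ℝ ∞ Φ →
    Continuous fun p : E × ℝ => iteratedDeriv i (fun t => Φ (p.1, t)) p.2 := by
  induction i with
  | zero =>
    intro Φ hΦ
    simpa using hΦ.continuous
  | succ i ih =>
    intro Φ hΦ
    have hD : ContDiff ℝ ∞ fun p => fderiv ℝ Φ p (0, 1) :=
      (hΦ.fderiv_right (m := ∞) (by simp)).clm_apply contDiff_const
    have hder : ∀ y : E, deriv (fun t => Φ (y, t)) = fun t => fderiv ℝ Φ (y, t) (0, 1) := by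
      intro y
      ext t
      have h1 : HasDerivAt (fun t : ℝ => (y, t)) ((0 : E), (1 : ℝ)) t :=
        (hasDerivAt_const t y).prodMk (hasDerivAt_id t)
      exact (((hΦ.differentiable (by simp)) (y, t)).hasFDerivAt.comp_hasDerivAt t h1).deriv
    simp only [iteratedDeriv_succ', hder]
    exact ih hD

lemma smoothConv_of_tendsto {Φ : E × ℝ → ℝ} (hΦ : ContDiff ℝ ∞ Φ) {l : Filter ℕ} {x : ℕ → E}
    {y : E} (hx : Tendsto x l (𝓝 y)) :
    SmoothConv l (fun n t => Φ (x n, t)) (fun t => Φ (y, t)) := by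
  have hs : ∀ z : E, ContDiff ℝ ∞ fun t => Φ (z, t) := fun z =>
    hΦ.comp (contDiff_const.prodMk contDiff_id)
  refine ⟨fun n => hs _, hs y, fun i t => ?_⟩
  have h1 := (continuous_iteratedDeriv_partial i hΦ).tendsto (y, t)
  rw [nhds_prod_eq] at h1
  exact h1.comp (hx.prodMap tendsto_id)

end Smooth

/-! ### Non-degeneracy and zeros of derivatives -/

/-- The extension `G` is merely smooth, so its zeros are controlled through the analytic `g`.
Derivatives within `[0,1]` link the two, endpoints included, and the zeros of a nontrivial analytic
function on a connected set are discrete, hence null. -/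
lemma ae_iteratedDeriv_ne_zero {g G : ℝ → ℝ} (hg : AnalyticOnNhd ℝ g (Set.Icc 0 1))
    (hG : ContDiff ℝ ∞ G) (hgG : Set.EqOn G g (Set.Icc 0 1)) {j : ℕ}
    (h : ∃ t ∈ Set.Icc (0 : ℝ) 1, iteratedDerivWithin j G (Set.Icc 0 1) t ≠ 0) :
    ∀ᵐ t ∂volume.restrict (Set.Icc (0 : ℝ) 1), iteratedDeriv j G t ≠ 0 := by
  have hU : UniqueDiffOn ℝ (Set.Icc (0 : ℝ) 1) := uniqueDiffOn_Icc_zero_one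
  have e : ∀ t ∈ Set.Icc (0 : ℝ) 1, iteratedDerivWithin j G (Set.Icc 0 1) t =
      iteratedDeriv j g t := fun t ht => by
      rw [iteratedDerivWithin_congr hgG ht,
        iteratedDerivWithin_eq_iteratedDeriv hU (hg t ht).contDiffAt ht]
  have e' : ∀ t ∈ Set.Icc (0 : ℝ) 1, iteratedDerivWithin j G (Set.Icc 0 1) t =
      iteratedDeriv j G t := fun t ht => iteratedDerivWithin_eq_iteratedDeriv hU
      (hG.contDiffAt.of_le (by exact_mod_cast le_top)) ht
  have han : AnalyticOnNhd ℝ (iteratedDeriv j g) (Set.Icc 0 1) := by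
    rw [iteratedDeriv_eq_iterate]
    exact hg.iterated_deriv j
  obtain ⟨t, ht, hne⟩ := h
  rw [e t ht] at hne
  have h1 : ∀ᵐ t ∂volume.restrict (Set.Icc (0 : ℝ) 1), iteratedDeriv j g t ≠ 0 :=
    ae_restrict_le_codiscreteWithin measurableSet_Icc
      (han.preimage_zero_mem_codiscreteWithin hne ht (isConnected_Icc zero_le_one))
  filter_upwards [h1, ae_restrict_mem measurableSet_Icc] with s hs hs'
  rwa [← e' s hs', e s hs']

lemma iteratedDerivWithin_eqOn_zero_of_le {g : ℝ → ℝ} {s : Set ℝ} {j k : ℕ} (hjk : j ≤ k)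
    (h : Set.EqOn (iteratedDerivWithin j g s) 0 s) : Set.EqOn (iteratedDerivWithin k g s) 0 s := by
  induction k, hjk using Nat.le_induction with
  | base => exact h
  | succ k _ ih =>
    intro t ht
    rw [iteratedDerivWithin_succ, derivWithin_congr ih (ih ht)]
    simp

lemma sum_mul_curveDeriv {d : ℕ} {γ : ℝ → (Fin d → ℝ)} (h : Fin d → ℤ) (j : ℕ)
    (hγ : ∀ i, ContDiffOn ℝ ∞ (fun s => γ s i) (Set.Icc 0 1)) {t : ℝ}
    (ht : t ∈ Set.Icc (0 : ℝ) 1) :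
    ∑ i, (h i : ℝ) * curveDeriv γ j t i
      = iteratedDerivWithin j (fun s => ∑ i, (h i : ℝ) * γ s i) (Set.Icc 0 1) t := by
  have hU : UniqueDiffOn ℝ (Set.Icc (0 : ℝ) 1) := uniqueDiffOn_Icc_zero_one
  have hc : ∀ i, ContDiffWithinAt ℝ j (fun s => γ s i) (Set.Icc 0 1) t := fun i =>
    (hγ i t ht).of_le (by exact_mod_cast le_top)
  rw [iteratedDerivWithin_fun_sum ht hU fun i _ => contDiffWithinAt_const.mul (hc i)]
  refine Finset.sum_congr rfl fun i _ => ?_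
  rw [iteratedDerivWithin_const_mul ht hU _ (hc i), curveDeriv]

lemma exists_le_mem_nondegenerateOrders {d : ℕ} {γ : ℝ → (Fin d → ℝ)} {j : ℕ} (hj : 1 ≤ j)
    (h : (j : ℕ∞) ≤ curveOrder γ) : ∃ k ∈ nondegenerateOrders γ, j ≤ k := by
  by_contra! hlt
  have h1 : curveOrder γ ≤ ((j - 1 : ℕ) : ℕ∞) :=
    iSup₂_le fun k hk => by
      have := hlt k hk
      exact_mod_cast (by omega : k ≤ j - 1)
  have h2 : j ≤ j - 1 := by exact_mod_cast h.trans h1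
  omega

/-- The order is a supremum, so non-degeneracy is only known at some `k ≥ j`. An identically
vanishing `j`-th derivative would force the `k`-th to vanish too. -/
lemma exists_iteratedDerivWithin_ne_zero {d : ℕ} {γ : ℝ → (Fin d → ℝ)}
    (hγ : ∀ i, ContDiffOn ℝ ∞ (fun s => γ s i) (Set.Icc 0 1)) {j : ℕ} (hj : 1 ≤ j)
    (hord : (j : ℕ∞) ≤ curveOrder γ) {h : Fin d → ℤ} (hh : h ≠ 0) :
    ∃ t ∈ Set.Icc (0 : ℝ) 1,
      iteratedDerivWithin j (fun s => ∑ i, (h i : ℝ) * γ s i) (Set.Icc 0 1) t ≠ 0 := by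
  obtain ⟨k, ⟨-, hk⟩, hjk⟩ := exists_le_mem_nondegenerateOrders hj hord
  obtain ⟨t, ht, hne⟩ := hk h hh
  rw [sum_mul_curveDeriv h k hγ ht] at hne
  by_contra! hz
  exact hne (iteratedDerivWithin_eqOn_zero_of_le hjk hz ht)

/-! ### Ultrafilter limits and the main theorem -/

/-- Exponential sums along an analytic family whose derivatives up to order `k` do not vanish
identically. -/
lemma tendsto_expSum_of_nondegenerate {E : Type*} [NormedAddCommGroup E] [NormedSpace ℝ E]
    {C : Set E} (hC : IsCompact C) {Φ : E × ℝ → ℝ} (hΦ : ContDiff ℝ ∞ Φ) {k : ℕ}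
    (hne : ∀ y ∈ C, ∀ j, 1 ≤ j → j ≤ k →
      ∀ᵐ t ∂volume.restrict (Set.Icc (0 : ℝ) 1), iteratedDeriv j (fun t => Φ (y, t)) t ≠ 0)
    {ρ : ℕ → ℝ} (hρ : Tendsto ρ atTop atTop) (hρk : ρ =o[atTop] fun n : ℕ => (n : ℝ) ^ k)
    {x : ℕ → E} (hx : ∀ n, x n ∈ C) :
    Tendsto (fun n => expSum n fun t => ρ n * Φ (x n, t)) atTop (𝓝 0) := by
  rw [tendsto_iff_ultrafilter]
  intro U hU
  obtain ⟨y, hy, hxy⟩ := hC.ultrafilter_le_nhds (U.map x) (by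
    rw [Ultrafilter.coe_map, le_principal_iff, mem_map]
    exact Filter.univ_mem' hx)
  rw [Ultrafilter.coe_map] at hxy
  have hF : SmoothConv U (fun n t => Φ (x n, t)) (fun t => Φ (y, t)) :=
    smoothConv_of_tendsto hΦ hxy
  have hex : ∃ j : ℕ, Tendsto (fun n : ℕ => ρ n / (n : ℝ) ^ j) U (𝓝 0) :=
    ⟨k, hρk.tendsto_div_nhds_zero.mono_left hU⟩
  classical
  obtain ⟨j, hj, hmin⟩ : ∃ j : ℕ, Tendsto (fun n : ℕ => ρ n / (n : ℝ) ^ j) U (𝓝 0) ∧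
      ∀ i < j, ¬ Tendsto (fun n : ℕ => ρ n / (n : ℝ) ^ i) U (𝓝 0) :=
    ⟨Nat.find hex, Nat.find_spec hex, fun i hi => Nat.find_min hex hi⟩
  have hjk : j ≤ k := by
    by_contra! hlt
    exact hmin k hlt (hρk.tendsto_div_nhds_zero.mono_left hU)
  have hρU : Tendsto ρ U atTop := hρ.mono_left hU
  have hj1 : 1 ≤ j := by
    rw [Nat.one_le_iff_ne_zero]
    rintro rfl
    simp only [pow_zero, div_one] at hj
    exact not_tendsto_nhds_of_tendsto_atTop hρU 0 hj
  rw [Metric.tendsto_nhds]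
  intro ε hε
  simp only [dist_zero_right]
  obtain ⟨i, rfl⟩ : ∃ i, j = i + 1 := ⟨j - 1, by omega⟩
  rcases Nat.eq_zero_or_pos i with rfl | hi
  -- When `j = 1` the amplitude tends to infinity and so exceeds any `A`.
  · obtain ⟨A, -, hT⟩ := derivativeTest_one hU _ (hne y hy 1 le_rfl hjk) ε hε
    refine hT _ ρ hF hj ?_
    filter_upwards [hρU.eventually_ge_atTop A] with n hn
    simpa using hn.trans (le_abs_self _)
  · obtain ⟨i, rfl⟩ : ∃ i', i = i' + 1 := ⟨i - 1, by omega⟩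
    -- Along an ultrafilter, failure to converge to 0 gives a lower bound that holds eventually, not
    -- just frequently. This is the reason for using ultrafilters.
    have h1 := hmin (i + 1) (by omega)
    rw [Metric.tendsto_nhds] at h1
    push Not at h1
    obtain ⟨c, hc, h2⟩ := h1
    refine (derivativeTest hU i).succ hU (by omega) (hne y hy _ hj1 hjk) hc hF hj ?_ hε
    filter_upwards [h2, hU (eventually_gt_atTop 0)] with n hn hn0
    have hn' : (0 : ℝ) < n := by exact_mod_cast hn0
    rw [dist_zero_right, norm_div, Real.norm_eq_abs, Real.norm_eq_abs,
      abs_of_pos (by positivity : 0 < (n : ℝ) ^ (i + 1)), le_div_iff₀ (by positivity)] at hn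
    exact hn

end DilatingCurves

end

theorem theorem1p2 (m d : ℕ) (φ : (Fin m → ℝ) → ℝ → (Fin d → ℝ)) (κ : ℕ∞)
    (hφ : DilatingCurves.IsAnalyticFamily φ)
    (hRND : DilatingCurves.IsRND φ κ)
    (hκ : 2 ≤ κ)
    (ρ : ℕ → ℝ) (hρ : Tendsto ρ atTop atTop)
    (hfin : ∀ k : ℕ, κ = (k : ℕ∞) → ρ =o[atTop] (fun n : ℕ => (n : ℝ) ^ k))
    (hinf : κ = ⊤ → ∃ l : ℕ, ρ =o[atTop] (fun n : ℕ => (n : ℝ) ^ l))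
    (x : ℕ → (Fin m → ℝ)) (hx : ∀ n, x n ∈ DilatingCurves.cube m) :
    DilatingCurves.Equidistributes
      (fun n => DilatingCurves.countingMeasure (fun t => ρ n • φ (x n) t) n) := by
  open DilatingCurves in
  open scoped ContDiff in
  obtain ⟨k, hkκ, hρk⟩ : ∃ k : ℕ, (k : ℕ∞) ≤ κ ∧ ρ =o[atTop] (fun n : ℕ => (n : ℝ) ^ k) := by
    rcases eq_or_ne κ ⊤ with h | h
    · obtain ⟨l, hl⟩ := hinf h
      exact ⟨l, h ▸ le_top, hl⟩
    · obtain ⟨k, rfl⟩ := ENat.ne_top_iff_exists.1 h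
      exact ⟨k, le_rfl, hfin k rfl⟩
  obtain ⟨ψ, hψ, hφψ⟩ := hφ
  have hcube : IsCompact (cube m) := isCompact_Icc
  -- Differencing samples the curves at points `(k + b) / n` beyond 1, so a globally smooth
  -- extension is needed.
  obtain ⟨Ψ, hΨ, hΨψ⟩ := exists_contDiff_eqOn (hcube.isClosed.prod isClosed_Icc) hψ
  have hφΨ : ∀ y ∈ cube m, ∀ t ∈ Set.Icc (0 : ℝ) 1, φ y t = Ψ (y, t) := fun y hy t ht => by
    rw [hφψ y hy t ht, hΨψ (Set.mk_mem_prod hy ht)]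
  refine equidistributes_of_expSum _ fun h hh => ?_
  set Φ : (Fin m → ℝ) × ℝ → ℝ := fun p => ∑ i, (h i : ℝ) * Ψ p i with hΦdef
  have hΨi : ∀ i, ContDiff ℝ ∞ fun p => Ψ p i := contDiff_pi.1 hΨ
  have hΦ : ContDiff ℝ ∞ Φ := ContDiff.sum fun i _ => contDiff_const.mul (hΨi i)
  have hline : ∀ y : Fin m → ℝ, ContDiff ℝ ∞ fun t : ℝ => (y, t) := fun y =>
    contDiff_const.prodMk contDiff_id
  have hmain := tendsto_expSum_of_nondegenerate hcube hΦ (k := k)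
    (fun y hy j hj hjk => ?_) hρ hρk hx
  · refine hmain.congr' ?_
    filter_upwards with n
    unfold expSum
    congr 1
    refine Finset.sum_congr rfl fun a ha => ?_
    have han := Finset.mem_Icc.1 ha
    have hn : (0 : ℝ) < n := by exact_mod_cast (by omega : 0 < n)
    have hmem : (a : ℝ) / n ∈ Set.Icc (0 : ℝ) 1 :=
      ⟨by positivity, by rw [div_le_one hn]; exact_mod_cast han.2⟩
    congr 1
    simp only [hΦdef, Finset.mul_sum, Pi.smul_apply, smul_eq_mul, hφΨ _ (hx n) _ hmem]
    exact Finset.sum_congr rfl fun i _ => by ring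
  · have heq : Set.EqOn (fun t => ∑ i, (h i : ℝ) * φ y t i) (fun t => Φ (y, t)) (Set.Icc 0 1) :=
      fun t ht => by simp only [hΦdef, hφΨ y hy t ht]
    have hord : (j : ℕ∞) ≤ curveOrder (φ y) := by
      refine le_trans (by exact_mod_cast hjk) (hkκ.trans ?_)
      rw [hRND]
      exact iInf₂_le y hy
    have hsm : ∀ i, ContDiffOn ℝ ∞ (fun s => φ y s i) (Set.Icc 0 1) := fun i =>
      (((hΨi i).comp (hline y)).contDiffOn).congr fun t ht => by
        simp only [hφΨ y hy t ht, Function.comp]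
    obtain ⟨t, ht, hne⟩ := exists_iteratedDerivWithin_ne_zero hsm hj hord hh
    rw [iteratedDerivWithin_congr heq ht] at hne
    -- Analyticity on `[0,1]` comes from the original `ψ`, since the cutoff extension `Ψ` need not
    -- be analytic.
    refine ae_iteratedDeriv_ne_zero (g := fun t => ∑ i, (h i : ℝ) * ψ (y, t) i) ?_
      (hΦ.comp (hline y)) (fun t ht => ?_) ⟨t, ht, hne⟩
    · refine Finset.analyticOnNhd_fun_sum _ fun i _ => analyticOnNhd_const.mul fun t ht => ?_
      have h1 : AnalyticAt ℝ ψ (y, t) := hψ _ (Set.mk_mem_prod hy ht)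
      have h2 : AnalyticAt ℝ (fun p => ψ p i) (y, t) := analyticAt_pi_iff.1 h1 i
      exact h2.comp (analyticAt_const.prod analyticAt_id)
    · simp only [hΦdef, Function.comp, hΨψ (Set.mk_mem_prod hy ht)]
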